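/- Let $K$ be a number field and let $v$ be a non-archimedean place of $K$, with absolute value $|\cdot|_v$ normalized so that it restricts to the usual $p$-adic absolute value on $\mathbb{Q}$ for some prime $p$. Let $\mathbb{C}_v$ be the completion of an algebraic closure of $K_v$, with the extended absolute value, and regard $\overline{\mathbb{Q}}$ as a subfield of $\mathbb{C}_v$ by means of an embedding $\overline{\mathbb{Q}}\hookrightarrow\mathbb{C}_v$. For $\phi(z)=a_dz^d+\dots+a_0\in\mathbb{C}_v[z]$ of degree $d\ge 2$ put $$G_{\phi,v}(z)=\lim_{n\to\infty}\frac1{d^n}\log\max\{1,|\phi^n(z)|_v\},\qquad M_v(\phi)=\max\{G_{\phi,v}(c):c\in\mathbb{C}_v,\ \phi'(c)=0\},$$ where $\phi^n$ is the $n$-th iterate, $$C_{\phi,v}=|2d|_v\max_{0\le i<d}\left\{1,\left|\frac{a_i}{a_d}\right|_v^{1/(d-i)},|a_d|_v^{-1/(d-1)}\right\},\qquad B_{\phi,v}(\infty)=\{z\in\mathbb{C}_v:|z|_v>C_{\phi,v}\}.$$ For $\mathbf{c}=(c_1,\dots,c_{d-1})\in\overline{\mathbb{Q}}^{\,d-1}$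 let $$f_{\mathbf{c}}(z)=\sum_{k=0}^{d-1}\frac{(-1)^k e_k(c_1,\dots,c_{d-1})}{d-k}\,z^{d-k},$$ where $e_k$ is the $k$-th elementary symmetric polynomial; equivalently, $f_{\mathbf{c}}(0)=0$ and $f_{\mathbf{c}}'(z)=\prod_{i=1}^{d-1}(z-c_i)$. **Proposition.** Let $d\ge2$. There is a real constant $\delta_v$, depending only on $d$ and $v$, such that for every $\mathbf{c}\in\overline{\mathbb{Q}}^{\,d-1}$, every $\alpha\in\mathbb{C}_v$ with $\alpha\notin B_{f_{\mathbf{c}},v}(\infty)$, and every $y\in\mathbb{C}_v$ with $f_{\mathbf{c}}^3(y)=\alpha$, $$\min_{\beta\in\mathbb{C}_v,\ f_{\mathbf{c}}^3(\beta)=0}\log|y-\beta|_v\le-\frac1{d-1}M_v(f_{\mathbf{c}})+\delta_v,$$ where $f_{\mathbf{c}}^3$ is the third iterate and $\log 0=-\infty$. -/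

import Mathlib

open Polynomial

noncomputable section

/-! ### Non-archimedean places of a number field and the field `ℂ_v` -/

/-- A non-archimedean place of a number field `K`, given by its normalized absolute value: the one
that restricts to the usual `p`-adic absolute value (`|p| = 1 / p`) on `ℚ` for some prime `p`. -/
structure NonarchPlace (K : Type*) [Field K] [NumberField K] where
  /-- The absolute value `|·|_v`. -/
  abv : AbsoluteValue K ℝ
  nonarch : IsNonarchimedean abv
  normalized : ∃ p : ℕ, p.Prime ∧ ∀ q : ℚ, abv (q : K) = (padicNorm p q : ℝ)

namespace NonarchPlace

variable {K : Type*} [Field K] [NumberField K] (v : NonarchPlace K)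

/-- The completion `K_v` of `K` at `v`. -/
abbrev LocalField : Type _ := v.abv.Completion

theorem norm_coe (x : K) : ‖((WithAbs.toAbs v.abv x : WithAbs v.abv) : v.LocalField)‖ = v.abv x :=
  UniformSpace.Completion.norm_coe _

instance : NontriviallyNormedField v.LocalField where
  __ := (inferInstance : NormedField v.LocalField)
  non_trivial := by
    obtain ⟨p, hp, h⟩ := v.normalized
    have hp' := Fact.mk hp
    refine ⟨((WithAbs.toAbs v.abv (((p : ℚ)⁻¹ : ℚ) : K) : WithAbs v.abv) : v.LocalField), ?_⟩
    have h1 : v.abv (((p : ℚ)⁻¹ : ℚ) : K) = (p : ℝ) := by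
      rw [Rat.cast_inv, map_inv₀, h, padicNorm.padicNorm_p_of_prime]
      simp
    have h2 := v.norm_coe (((p : ℚ)⁻¹ : ℚ) : K)
    rw [h1] at h2
    have h3 : (1 : ℝ) < (p : ℝ) := by exact_mod_cast hp.one_lt
    rw [← h2] at h3
    exact h3

instance : IsUltrametricDist v.LocalField := by
  refine IsUltrametricDist.isUltrametricDist_of_forall_norm_add_le_max_norm fun x y => ?_
  induction x, y using UniformSpace.Completion.induction_on₂ with
  | hp => exact isClosed_le (by fun_prop) (by fun_prop)
  | ih a b =>
    rw [← UniformSpace.Completion.coe_add]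
    simp only [UniformSpace.Completion.norm_coe]
    exact v.nonarch a.ofAbs b.ofAbs

/-- An algebraic closure of `K_v`. -/
abbrev AlgCl : Type _ := AlgebraicClosure v.LocalField

/-- The algebraic closure of `K_v` carries the unique absolute value that extends the one of
`K_v`. -/
instance : NormedField v.AlgCl := spectralNorm.normedField v.LocalField v.AlgCl

/-- The field `ℂ_v`: the completion of an algebraic closure of `K_v`. -/
abbrev Cv : Type _ := UniformSpace.Completion v.AlgCl

instance : NormedField v.Cv := inferInstance

end NonarchPlace

/-! ### Dynamics of polynomials over a normed field -/

namespace PolyDynamics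

section

variable {L : Type*} [NormedField L]

/-- The map `φ^n`, the `n`-th iterate of `z ↦ φ(z)`. -/
def iter (φ : L[X]) (n : ℕ) : L → L := (fun z => φ.eval z)^[n]

/-- The escape-rate function
`G_φ(z) = lim_{n → ∞} d^{-n} log max {1, |φ^n(z)|}` of a polynomial `φ` of degree `d`. -/
def escapeRate (φ : L[X]) (z : L) : ℝ :=
  Filter.limUnder Filter.atTop
    (fun n : ℕ => 1 / (φ.natDegree : ℝ) ^ n * Real.log (max 1 ‖iter φ n z‖))

/-- `M(φ) = max {G_φ(c) : φ'(c) = 0}`. -/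
def maxCriticalRate (φ : L[X]) : ℝ :=
  sSup (escapeRate φ '' {c : L | φ.derivative.eval c = 0})

/-- The radius
`C_φ = |2d| max_{0 ≤ i < d} {1, |a_i / a_d|^{1/(d-i)}, |a_d|^{-1/(d-1)}}` of a polynomial
`φ = a_d z^d + ... + a_0` of degree `d`. (An index `i = d` would contribute `|a_d / a_d| = 1`.) -/
def escapeRadius (φ : L[X]) : ℝ :=
  ‖(2 * φ.natDegree : L)‖ *
    max (max 1 (‖φ.leadingCoeff‖ ^ (-(1 / ((φ.natDegree : ℝ) - 1)))))
      (⨆ i : Fin φ.natDegree,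
        ‖φ.coeff i / φ.leadingCoeff‖ ^ (1 / ((φ.natDegree : ℝ) - (i : ℝ))))

/-- The set `B_φ(∞)`, the complement of the closed disk of radius `C_φ` around `0`. -/
def basinInfty (φ : L[X]) : Set L := (Metric.closedBall 0 (escapeRadius φ))ᶜ

/-- `log |x|`, with the value `-∞` at `x = 0`. -/
def logAbs (x : L) : EReal := ENNReal.log ‖x‖ₑ

end

/-- The polynomial
`f_c(z) = z^d / d - (c_1 + ... + c_{d-1}) z^{d-1} / (d-1) + ... + (-1)^{d-1} c_1 ⋯ c_{d-1} z`,
whose coefficient at `z^{d-k}`, for `0 ≤ k ≤ d - 1`, is `(-1)^k e_k(c_1, ..., c_{d-1}) / (d - k)`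
with `e_k` the `k`-th elementary symmetric polynomial. -/
def normalForm {F : Type*} [Field F] (d : ℕ) (c : Fin (d - 1) → F) : F[X] :=
  ∑ k ∈ Finset.range d,
    C ((-1) ^ k * (Finset.univ.val.map c).esymm k / ((d - k : ℕ) : F)) * X ^ (d - k)

end PolyDynamics

end

/-!
Write `N = max 1 (max |c_i|)` and `f = f_c`. The coefficients of `f` satisfy `|a_j| ≤ A N^(d-j)`
with `A` depending only on `d` and `v`. This gives `|f(z)| ≤ A max(N, |z|)^d`, hence
`M(f) ≤ log N + 2 log A` (`escapeRate_le`), it gives `C_f ≤ A N` (`escapeRadius_le`), and it shows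
that `|f(z)| ≤ A N` forces `|z| ≤ A N` (`norm_le_of_norm_eval_le`). So it is enough to find a root
`β` of `f^3` with `|y - β|^(d-1) ≤ B / N` for a constant `B`. If `N` is bounded, then so is `y`, and
`β = 0` will do.

If `N` is large, it is the absolute value of a critical point. An ultrametric form of the
Gauss–Lucas theorem says that if all roots of a polynomial of degree `d` lie in the disk
`|b| ≤ ρ`, then its critical points satisfy `|d| |c| ≤ ρ`
(`norm_card_mul_norm_le_of_derivative_eq_zero`). For `|t| ≤ ρ^d` some root of `f - t` lies in that
disk, because `f(0) = 0`. Taking `ρ = ε N` with `ε < |d|`, the roots of `f - t` therefore do not lie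
in a single disk of radius `ρ`, and every point `z` is at distance more than `ρ` from one of them.
In `|f(z) - t| ≥ ∏ |z - b|` one factor is thus at least `ρ`, and some other root `b` satisfies
`ρ |z - b|^(d-1) ≤ |f(z) - t|` (`exists_preimage_near`). Pulling back `α` and `0` along
`f` three times (`exists_root_iterate_three_near`), the distance to the nearest preimage is first
`O(1)`, since `|α - 0| ≤ A N`; it stays `O(1)` at the second step, and at the third step it is
`O(N^(-1/(d-1)))`.

All roots involved are algebraic over `ℚ`, so the algebraic closedness of `ℂ_v` is not needed.
-/

open Polynomial

namespace PolyDynamics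

/-! ### Roots and critical points over an ultrametric field -/

theorem exists_pow_card_le_prod {α : Type*} (g : α → ℝ) (hg : ∀ a, 0 ≤ g a) (s : Multiset α)
    (hs : s ≠ 0) : ∃ a ∈ s, g a ^ s.card ≤ (s.map g).prod := by
  induction s using Multiset.induction with
  | empty => exact absurd rfl hs
  | cons a s ih =>
    rcases eq_or_ne s 0 with rfl | hs'
    · exact ⟨a, by simp, by simp⟩
    · obtain ⟨b, hb, hle⟩ := ih hs'
      rw [Multiset.map_cons, Multiset.prod_cons, Multiset.card_cons]
      rcases le_total (g a) (g b) with hab | hab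
      · refine ⟨a, by simp, ?_⟩
        rw [pow_succ']
        exact mul_le_mul_of_nonneg_left ((pow_le_pow_left₀ (hg a) hab _).trans hle) (hg a)
      · refine ⟨b, by simp [hb], ?_⟩
        rw [pow_succ']
        exact mul_le_mul hab hle (pow_nonneg (hg b) _) (hg a)

theorem norm_prod_map {α L : Type*} [NormedField L] (g : α → L) (s : Multiset α) :
    ‖(s.map g).prod‖ = (s.map fun a => ‖g a‖).prod := by
  have h := map_multiset_prod (normHom : L →*₀ ℝ) (s.map g)
  rw [Multiset.map_map] at h
  exact h

section Ultrametric

variable {L : Type*} [NormedField L] [IsUltrametricDist L]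

theorem norm_add_le_of_le {x y : L} {r : ℝ} (hx : ‖x‖ ≤ r) (hy : ‖y‖ ≤ r) : ‖x + y‖ ≤ r :=
  (IsUltrametricDist.norm_add_le_max x y).trans (max_le hx hy)

theorem norm_sub_le_of_le {x y : L} {r : ℝ} (hx : ‖x‖ ≤ r) (hy : ‖y‖ ≤ r) : ‖x - y‖ ≤ r := by
  rw [sub_eq_add_neg]
  exact norm_add_le_of_le hx (by rwa [norm_neg])

theorem norm_eval_prod_X_sub_C_le (s : Multiset L) (c : L) (hs : ∀ b ∈ s, ‖b‖ ≤ ‖c‖) :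
    ‖((s.map fun b => X - C b).prod).eval c‖ ≤ ‖c‖ ^ s.card := by
  induction s using Multiset.induction with
  | empty => simp
  | cons b s ih =>
    have ih' := ih fun x hx => hs x (Multiset.mem_cons_of_mem hx)
    have hb := hs b (Multiset.mem_cons_self b s)
    simp only [Multiset.map_cons, Multiset.prod_cons, eval_mul, norm_mul, Multiset.card_cons,
      pow_succ', eval_sub, eval_X, eval_C]
    gcongr
    exact norm_sub_le_of_le le_rfl hb

theorem norm_eval_prod_X_sub_C_sub_pow_le (s : Multiset L) (c : L) {ρ : ℝ} (hρ0 : 0 ≤ ρ)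
    (hρ : ρ ≤ ‖c‖) (hs : ∀ b ∈ s, ‖b‖ ≤ ρ) :
    ‖c‖ * ‖((s.map fun b => X - C b).prod).eval c - c ^ s.card‖ ≤ ρ * ‖c‖ ^ s.card := by
  induction s using Multiset.induction with
  | empty => simpa using hρ0
  | cons b s ih =>
    have ih' := ih fun x hx => hs x (Multiset.mem_cons_of_mem hx)
    have hb := hs b (Multiset.mem_cons_self b s)
    have hP := norm_eval_prod_X_sub_C_le s c fun x hx =>
      (hs x (Multiset.mem_cons_of_mem hx)).trans hρ
    simp only [Multiset.map_cons, Multiset.prod_cons, eval_mul, Multiset.card_cons,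
      eval_sub, eval_X, eval_C]
    set P := ((s.map fun b => X - C b).prod).eval c
    rw [show (c - b) * P - c ^ (s.card + 1) = c * (P - c ^ s.card) - b * P by ring, ← norm_mul,
      mul_sub]
    refine norm_sub_le_of_le ?_ ?_
    · rw [norm_mul, norm_mul]
      calc _ ≤ ‖c‖ * (ρ * ‖c‖ ^ s.card) := by gcongr
        _ = _ := by ring
    · rw [norm_mul, norm_mul]
      calc _ ≤ ‖c‖ * (ρ * ‖c‖ ^ s.card) := by
            gcongr
        _ = _ := by ring

/-- When all roots are small compared with `c`, the derivative at `c` is close to `n c^(n-1)`. The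
estimate is multiplied by `‖c‖` twice to keep the exponents free of subtraction. -/
theorem norm_derivative_prod_X_sub_C_sub_le (s : Multiset L) (c : L) {ρ : ℝ} (hρ0 : 0 ≤ ρ)
    (hρ : ρ ≤ ‖c‖) (hs : ∀ b ∈ s, ‖b‖ ≤ ρ) :
    ‖c‖ * ‖c * (derivative (s.map fun b => X - C b).prod).eval c - s.card * c ^ s.card‖ ≤
      ρ * ‖c‖ ^ s.card := by
  induction s using Multiset.induction with
  | empty => simpa using hρ0
  | cons b s ih =>
    have hs' : ∀ x ∈ s, ‖x‖ ≤ ρ := fun x hx => hs x (Multiset.mem_cons_of_mem hx)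
    have ih' := ih hs'
    have hb := hs b (Multiset.mem_cons_self b s)
    have hP := norm_eval_prod_X_sub_C_sub_pow_le s c hρ0 hρ hs'
    simp only [Multiset.map_cons, Multiset.prod_cons, derivative_mul, eval_add, eval_mul,
      Multiset.card_cons, eval_sub, eval_X, eval_C, derivative_X_sub_C, one_mul,
      Nat.cast_add, Nat.cast_one]
    set P := ((s.map fun b => X - C b).prod).eval c
    set D := (derivative (s.map fun b => X - C b).prod).eval c
    rw [show c * (P + (c - b) * D) - ((s.card : L) + 1) * c ^ (s.card + 1) =
      c * (P - c ^ s.card) + ((c - b) * (c * D - s.card * c ^ s.card) - b * (s.card * c ^ s.card))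
      by ring, ← norm_mul, mul_add,
      mul_sub c ((c - b) * _)]
    refine norm_add_le_of_le ?_ (norm_sub_le_of_le ?_ ?_)
    · rw [norm_mul, norm_mul]
      calc _ ≤ ‖c‖ * (ρ * ‖c‖ ^ s.card) := by gcongr
        _ = _ := by ring
    · rw [mul_left_comm, norm_mul, norm_mul]
      calc _ ≤ ‖c‖ * (ρ * ‖c‖ ^ s.card) := by
            gcongr
            exact norm_sub_le_of_le le_rfl (hb.trans hρ)
        _ = _ := by ring
    · rw [norm_mul, norm_mul, norm_mul, norm_pow]
      calc _ ≤ ‖c‖ * (ρ * (1 * ‖c‖ ^ s.card)) := by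
            gcongr
            exact IsUltrametricDist.norm_natCast_le_one L _
        _ = _ := by ring

/-- An ultrametric Gauss–Lucas theorem: a disk around `0` that contains all roots of a monic split
polynomial of degree `n` contains `n c` for each critical point `c`. -/
theorem norm_card_mul_norm_le_of_derivative_eq_zero (s : Multiset L) (c : L) {ρ : ℝ}
    (hρ : 0 ≤ ρ) (hs : ∀ b ∈ s, ‖b‖ ≤ ρ)
    (hc : (derivative (s.map fun b => X - C b).prod).eval c = 0) :
    ‖(s.card : L)‖ * ‖c‖ ≤ ρ := by
  rcases le_total ‖c‖ ρ with h | h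
  · exact (mul_le_of_le_one_left (norm_nonneg c)
      (IsUltrametricDist.norm_natCast_le_one L _)).trans h
  rcases eq_or_ne c 0 with rfl | hc0
  · simpa using hρ
  have key := norm_derivative_prod_X_sub_C_sub_le s c hρ h hs
  rw [hc, mul_zero, zero_sub, norm_neg, norm_mul, norm_pow, ← mul_assoc] at key
  rw [mul_comm]
  exact le_of_mul_le_mul_right key (by positivity)

/-- The roots of a polynomial with a large critical point and a small constant term spread out: no
point `z` is within `ρ` of all of them. Otherwise they would all be close to each other, hence to
the smallest one, hence to `0`, against `norm_card_mul_norm_le_of_derivative_eq_zero`. -/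
theorem exists_lt_norm_sub (s : Multiset L) (hs0 : s ≠ 0) (c z : L) {ρ : ℝ} (hρ : 0 ≤ ρ)
    (hc : (derivative (s.map fun b => X - C b).prod).eval c = 0)
    (hρc : ρ < ‖(s.card : L)‖ * ‖c‖) (hprod : (s.map fun b => ‖b‖).prod ≤ ρ ^ s.card) :
    ∃ b ∈ s, ρ < ‖z - b‖ := by
  by_contra! hfar
  obtain ⟨b₀, hb₀, hle⟩ := exists_pow_card_le_prod (fun b : L => ‖b‖) (fun _ => norm_nonneg _) s hs0
  have hb₀ρ : ‖b₀‖ ≤ ρ :=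
    le_of_pow_le_pow_left₀ (by simpa using hs0) hρ (hle.trans hprod)
  refine absurd (norm_card_mul_norm_le_of_derivative_eq_zero s c hρ (fun b hb => ?_) hc)
    (not_le.mpr hρc)
  rw [show b = b₀ + ((z - b₀) - (z - b)) by ring]
  exact norm_add_le_of_le hb₀ρ (norm_sub_le_of_le (hfar _ hb₀) (hfar _ hb))

/-- If `p` has a large critical point, the factor of `p(z) - t` belonging to the root furthest from
`z` contributes at least `ρ`, so some preimage of `t` is closer to `z` than the generic exponent
`1 / d` would give. -/
theorem exists_preimage_near {F : Type*} [Field F] [IsAlgClosed F] (ι : F →+* L) (p : F[X])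
    (hdeg : 2 ≤ p.natDegree) (h0 : p.coeff 0 = 0) (hlc : 1 ≤ ‖ι p.leadingCoeff‖) (c : L)
    (hc : (derivative (p.map ι)).eval c = 0) {ρ : ℝ} (hρ : 0 ≤ ρ)
    (hρc : ρ < ‖(p.natDegree : L)‖ * ‖c‖) (t : F) (ht : ‖ι t‖ ≤ ρ ^ p.natDegree) (z : L) :
    ∃ b : F, p.eval b = t ∧
      ρ * ‖z - ι b‖ ^ (p.natDegree - 1) ≤ ‖(p.map ι).eval z - ι t‖ := by
  set q : F[X] := p - C t with hq
  have hqdeg : q.natDegree = p.natDegree := natDegree_sub_C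
  have hqlc : q.leadingCoeff = p.leadingCoeff := by
    rw [leadingCoeff, hqdeg, hq, coeff_sub, coeff_C_of_ne_zero (by omega), sub_zero, leadingCoeff]
  have hqprod : q = C p.leadingCoeff * (q.roots.map fun b => X - C b).prod := by
    rw [← hqlc]
    exact (IsAlgClosed.splits q).eq_prod_roots
  have hcard : q.roots.card = p.natDegree := by
    rw [← hqdeg]
    exact (IsAlgClosed.splits q).natDegree_eq_card_roots.symm
  set s : Multiset L := q.roots.map ι with hs
  have hscard : s.card = p.natDegree := by rw [hs, Multiset.card_map, hcard]
  have hs0 : s ≠ 0 := by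
    rw [← Multiset.card_pos]
    omega
  have hmap : p.map ι - C (ι t) = C (ι p.leadingCoeff) * (s.map fun b => X - C b).prod := by
    have := congrArg (Polynomial.map ι) hqprod
    rw [hq, Polynomial.map_sub, map_C, Polynomial.map_mul, map_C, Polynomial.map_multiset_prod,
      Multiset.map_map, ← hq] at this
    rw [this, hs, Multiset.map_map]
    simp
  have hlc0 : ι p.leadingCoeff ≠ 0 := by
    rw [← norm_pos_iff]
    linarith
  have hnorm : ∀ w : L, (s.map fun b => ‖w - b‖).prod ≤ ‖(p.map ι).eval w - ι t‖ := by
    intro w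
    have h1 := congrArg (fun r : L[X] => ‖r.eval w‖) hmap
    simp only [eval_sub, eval_C, eval_mul, norm_mul, eval_multiset_prod, Multiset.map_map,
      Function.comp_def, eval_X] at h1
    rw [h1, ← norm_prod_map]
    exact le_mul_of_one_le_left (norm_nonneg _) hlc
  have hder : (derivative (s.map fun b => X - C b).prod).eval c = 0 := by
    have h1 := congrArg (fun r : L[X] => (derivative r).eval c) hmap
    simp only [derivative_sub, derivative_C, sub_zero, hc, derivative_mul, zero_mul, zero_add,
      eval_mul, eval_C] at h1
    exact (mul_eq_zero.mp h1.symm).resolve_left hlc0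
  have hprod : (s.map fun b => ‖b‖).prod ≤ ρ ^ s.card := by
    have h1 := hnorm 0
    simp only [zero_sub, norm_neg] at h1
    rw [← coeff_zero_eq_eval_zero, coeff_map, h0, map_zero, zero_sub, norm_neg] at h1
    rw [hscard]
    exact h1.trans ht
  obtain ⟨b₀, hb₀, hfar⟩ := exists_lt_norm_sub s hs0 c z hρ hder (by rwa [hscard]) hprod
  obtain ⟨s', hs'⟩ := Multiset.exists_cons_of_mem hb₀
  have hs'card : s'.card = p.natDegree - 1 := by
    rw [← hscard, hs', Multiset.card_cons, Nat.add_sub_cancel]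
  obtain ⟨b, hb, hle⟩ := exists_pow_card_le_prod (fun b : L => ‖z - b‖) (fun _ => norm_nonneg _) s'
    (by rw [← Multiset.card_pos]; omega)
  have hbs : b ∈ s := by
    rw [hs']
    exact Multiset.mem_cons_of_mem hb
  obtain ⟨x, hx, rfl⟩ := Multiset.mem_map.mp hbs
  refine ⟨x, ?_, ?_⟩
  · have := (mem_roots'.mp hx).2
    rwa [hq, IsRoot, eval_sub, eval_C, sub_eq_zero] at this
  · refine le_trans ?_ (hnorm z)
    rw [hs', Multiset.map_cons, Multiset.prod_cons, ← hs'card]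
    exact mul_le_mul hfar.le hle (by positivity) (norm_nonneg _)

end Ultrametric

/-! ### Growth of polynomials and escape rates -/

section Growth

variable {L : Type*} [NormedField L]

/-- The limit that defines the escape rate exists. -/
theorem tendsto_escapeRate {f : L[X]} (hd : 2 ≤ f.natDegree) {B : ℝ} (hB : 1 ≤ B)
    (hf : ∀ z, ‖f.eval z‖ ≤ B * max 1 ‖z‖ ^ f.natDegree) (z : L) :
    Filter.Tendsto (fun n : ℕ => 1 / (f.natDegree : ℝ) ^ n * Real.log (max 1 ‖iter f n z‖))
      Filter.atTop (nhds (escapeRate f z)) := by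
  set d := f.natDegree
  have hd' : (2 : ℝ) ≤ d := by exact_mod_cast hd
  have hlogB : 0 ≤ Real.log B := Real.log_nonneg hB
  set u : ℕ → ℝ := fun n => 1 / (d : ℝ) ^ n * Real.log (max 1 ‖iter f n z‖) with hu
  have hu0 : ∀ n, 0 ≤ u n := fun n =>
    mul_nonneg (by positivity) (Real.log_nonneg (le_max_left _ _))
  set e : ℕ → ℝ := fun n => 1 / (d : ℝ) ^ n * Real.log B with he
  have hstep : ∀ n, Real.log (max 1 ‖iter f (n + 1) z‖) ≤
      Real.log B + d * Real.log (max 1 ‖iter f n z‖) := by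
    intro n
    have hpos : (0 : ℝ) < max 1 ‖iter f n z‖ := lt_max_of_lt_left one_pos
    rw [← Real.log_pow, ← Real.log_mul (by positivity) (by positivity)]
    refine Real.log_le_log (lt_max_of_lt_left one_pos) (max_le ?_ ?_)
    · exact one_le_mul_of_one_le_of_one_le hB (one_le_pow₀ (le_max_left _ _))
    · rw [iter, Function.iterate_succ_apply']
      exact hf _
  -- Adding `d⁻ⁿ log B` turns the sequence into a decreasing one; this uses `2 / d ≤ 1`.
  have hanti : Antitone fun n => u n + e n := by
    refine antitone_nat_of_succ_le fun n => ?_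
    have h1 : u (n + 1) ≤ u n + 1 / (d : ℝ) ^ (n + 1) * Real.log B := by
      calc u (n + 1) ≤ 1 / (d : ℝ) ^ (n + 1) *
            (Real.log B + d * Real.log (max 1 ‖iter f n z‖)) := by
              simp only [hu]
              gcongr
              exact hstep n
        _ = _ := by
              simp only [hu]
              field_simp
              ring
    have h2 : 2 * (1 / (d : ℝ) ^ (n + 1)) ≤ 1 / (d : ℝ) ^ n := by
      rw [pow_succ, mul_one_div, div_le_div_iff₀ (by positivity) (by positivity)]
      have := pow_pos (show (0 : ℝ) < d by linarith) n
      nlinarith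
    have h3 := mul_le_mul_of_nonneg_right h2 hlogB
    simp only [he]
    linarith
  have hbdd : BddBelow (Set.range fun n => u n + e n) := by
    refine ⟨0, ?_⟩
    rintro _ ⟨n, rfl⟩
    exact add_nonneg (hu0 n) (mul_nonneg (by positivity) hlogB)
  have he0 : Filter.Tendsto e Filter.atTop (nhds 0) := by
    have := (tendsto_pow_atTop_nhds_zero_of_lt_one (r := 1 / (d : ℝ)) (by positivity)
      (by rw [div_lt_one] <;> linarith)).mul_const (Real.log B)
    simpa [he] using this
  have hlim := (tendsto_atTop_ciInf hanti hbdd).sub he0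
  simp only [add_sub_cancel_right] at hlim
  exact tendsto_nhds_limUnder ⟨_, hlim⟩

/-- The extra factor `A` on the left makes the induction close: it is absorbed by `A^2 ≤ A^d`. -/
theorem mul_max_norm_iter_le {f : L[X]} (hd : 2 ≤ f.natDegree) {A N : ℝ} (hA : 1 ≤ A)
    (hN : 1 ≤ N) (hf : ∀ ρ, N ≤ ρ → ∀ z : L, ‖z‖ ≤ ρ → ‖f.eval z‖ ≤ A * ρ ^ f.natDegree) {z : L}
    (hz : ‖z‖ ≤ N) (n : ℕ) :
    A * max N ‖iter f n z‖ ≤ (A ^ 2 * N) ^ f.natDegree ^ n := by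
  have hA2 : 1 ≤ A ^ 2 := one_le_pow₀ hA
  have hAN : A * N ≤ A ^ 2 * N := by
    gcongr
    exact le_self_pow₀ hA two_ne_zero
  have hAN1 : 1 ≤ A ^ 2 * N := one_le_mul_of_one_le_of_one_le hA2 hN
  induction n with
  | zero =>
    simp only [iter, Function.iterate_zero, id_eq, max_eq_left hz, pow_zero, pow_one]
    exact hAN
  | succ n ih =>
    rw [mul_max_of_nonneg _ _ (by linarith)]
    refine max_le (hAN.trans (le_self_pow₀ hAN1 (by positivity))) ?_
    rw [iter, Function.iterate_succ_apply']
    calc A * ‖f.eval (iter f n z)‖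
        ≤ A * (A * max N ‖iter f n z‖ ^ f.natDegree) := by
          gcongr
          exact hf _ (le_max_left _ _) _ (le_max_right _ _)
      _ = A ^ 2 * max N ‖iter f n z‖ ^ f.natDegree := by ring
      _ ≤ A ^ f.natDegree * max N ‖iter f n z‖ ^ f.natDegree := by gcongr
      _ = (A * max N ‖iter f n z‖) ^ f.natDegree := by rw [mul_pow]
      _ ≤ ((A ^ 2 * N) ^ f.natDegree ^ n) ^ f.natDegree := by gcongr
      _ = _ := by rw [← pow_mul, ← pow_succ]

theorem escapeRate_le {f : L[X]} (hd : 2 ≤ f.natDegree) {A N : ℝ} (hA : 1 ≤ A)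
    (hN : 1 ≤ N) (hf : ∀ ρ, N ≤ ρ → ∀ z : L, ‖z‖ ≤ ρ → ‖f.eval z‖ ≤ A * ρ ^ f.natDegree) {z : L}
    (hz : ‖z‖ ≤ N) : escapeRate f z ≤ Real.log (A ^ 2 * N) := by
  have hB : ∀ z, ‖f.eval z‖ ≤ A * N ^ f.natDegree * max 1 ‖z‖ ^ f.natDegree := by
    intro z
    rw [mul_assoc, ← mul_pow]
    refine hf _ (le_mul_of_one_le_right (by linarith) (le_max_left _ _)) z ?_
    exact (le_max_right 1 _).trans (le_mul_of_one_le_left (by positivity) hN)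
  refine le_of_tendsto (tendsto_escapeRate hd
    (one_le_mul_of_one_le_of_one_le hA (one_le_pow₀ hN)) hB z) (Filter.Eventually.of_forall ?_)
  intro n
  have hpos : (0 : ℝ) < max 1 ‖iter f n z‖ := lt_max_of_lt_left one_pos
  have hd0 : (0 : ℝ) < (f.natDegree : ℝ) ^ n := by
    have : (0 : ℝ) < f.natDegree := by exact_mod_cast (by omega : 0 < f.natDegree)
    positivity
  rw [one_div, inv_mul_le_iff₀ hd0]
  have h := mul_max_norm_iter_le hd hA hN hf hz n
  have h1 : max 1 ‖iter f n z‖ ≤ (A ^ 2 * N) ^ f.natDegree ^ n :=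
    (max_le_max_right _ hN).trans ((le_mul_of_one_le_left (by positivity) hA).trans h)
  have h2 := Real.log_le_log hpos h1
  rw [Real.log_pow] at h2
  exact_mod_cast h2

theorem logAbs_le_of_norm_le_exp {x : L} {r : ℝ} (h : ‖x‖ ≤ Real.exp r) :
    logAbs x ≤ (r : EReal) := by
  rw [logAbs, ← ofReal_norm]
  refine (ENNReal.log_monotone (ENNReal.ofReal_le_ofReal h)).trans_eq ?_
  rw [ENNReal.log_ofReal_of_pos (Real.exp_pos r), Real.log_exp]

variable [IsUltrametricDist L]

theorem norm_eval_le {f : L[X]} {A N : ℝ} (hA : 0 ≤ A) (hN : 0 ≤ N)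
    (hf : ∀ j ≤ f.natDegree, ‖f.coeff j‖ ≤ A * N ^ (f.natDegree - j)) {ρ : ℝ} (hρ : N ≤ ρ)
    {z : L} (hz : ‖z‖ ≤ ρ) : ‖f.eval z‖ ≤ A * ρ ^ f.natDegree := by
  have hρ0 : 0 ≤ ρ := hN.trans hρ
  rw [eval_eq_sum_range]
  refine IsUltrametricDist.norm_sum_le_of_forall_le_of_nonneg (by positivity) fun j hj => ?_
  have hj' : j ≤ f.natDegree := Nat.lt_succ_iff.mp (Finset.mem_range.mp hj)
  rw [norm_mul, norm_pow]
  calc _ ≤ A * ρ ^ (f.natDegree - j) * ρ ^ j := by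
        gcongr
        exact (hf j hj').trans (by gcongr)
    _ = _ := by rw [mul_assoc, ← pow_add, Nat.sub_add_cancel hj']

/-- Outside the disk of radius `A N` the leading term dominates. -/
theorem norm_le_of_norm_eval_le {f : L[X]} (hd : 1 ≤ f.natDegree) (hlc : 1 ≤ ‖f.leadingCoeff‖)
    {A N : ℝ} (hA : 1 ≤ A) (hN : 1 ≤ N)
    (hf : ∀ j ≤ f.natDegree, ‖f.coeff j‖ ≤ A * N ^ (f.natDegree - j)) {z : L}
    (hz : ‖f.eval z‖ ≤ (A * N) ^ f.natDegree) : ‖z‖ ≤ A * N := by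
  by_contra! hlt
  have hNz : N ≤ ‖z‖ := (le_mul_of_one_le_left (by linarith) hA).trans hlt.le
  have hz0 : 0 < ‖z‖ := by linarith
  obtain ⟨m, hm⟩ : ∃ m, f.natDegree = m + 1 := ⟨f.natDegree - 1, by omega⟩
  have htail : ‖∑ j ∈ Finset.range f.natDegree, f.coeff j * z ^ j‖ ≤ A * N * ‖z‖ ^ m := by
    refine IsUltrametricDist.norm_sum_le_of_forall_le_of_nonneg (by positivity) fun j hj => ?_
    have hj' := Finset.mem_range.mp hj
    obtain ⟨i, hi⟩ : ∃ i, m = i + j := ⟨m - j, by omega⟩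
    rw [norm_mul, norm_pow]
    calc _ ≤ A * N ^ (f.natDegree - j) * ‖z‖ ^ j := by
          gcongr
          exact hf j hj'.le
      _ = A * N * N ^ i * ‖z‖ ^ j := by
          rw [show f.natDegree - j = i + 1 by omega]
          ring
      _ ≤ A * N * ‖z‖ ^ i * ‖z‖ ^ j := by gcongr
      _ = _ := by
          rw [hi]
          ring
  have hlt' : A * N * ‖z‖ ^ m < ‖z‖ ^ f.natDegree := by
    rw [hm, pow_succ']
    gcongr
  have heval : f.leadingCoeff * z ^ f.natDegree =
      f.eval z - ∑ j ∈ Finset.range f.natDegree, f.coeff j * z ^ j := by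
    rw [eval_eq_sum_range, Finset.sum_range_succ, leadingCoeff]
    ring
  have hmax : (A * N) ^ f.natDegree < ‖z‖ ^ f.natDegree := by
    gcongr
  have h1 : ‖f.leadingCoeff * z ^ f.natDegree‖ < ‖z‖ ^ f.natDegree := by
    rw [heval]
    exact lt_of_le_of_lt (norm_sub_le_of_le (hz.trans (le_max_left _ (A * N * ‖z‖ ^ m)))
      (htail.trans (le_max_right _ _))) (max_lt hmax hlt')
  rw [norm_mul, norm_pow] at h1
  exact absurd h1 (not_lt.mpr (le_mul_of_one_le_left (by positivity) hlc))

theorem escapeRadius_le {f : L[X]} (hd : 2 ≤ f.natDegree) (hlc : 1 ≤ ‖f.leadingCoeff‖)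
    {A N : ℝ} (hA : 1 ≤ A) (hN : 1 ≤ N)
    (hf : ∀ j ≤ f.natDegree, ‖f.coeff j‖ ≤ A * N ^ (f.natDegree - j)) :
    escapeRadius f ≤ A * N := by
  have hAN : 1 ≤ A * N := one_le_mul_of_one_le_of_one_le hA hN
  have hd' : (2 : ℝ) ≤ f.natDegree := by exact_mod_cast hd
  have h2d : ‖(2 * f.natDegree : L)‖ ≤ 1 := by
    have := IsUltrametricDist.norm_natCast_le_one L (2 * f.natDegree)
    push_cast at this
    exact this
  have : Nonempty (Fin f.natDegree) := ⟨⟨0, by omega⟩⟩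
  have hmax : max (max 1 (‖f.leadingCoeff‖ ^ (-(1 / ((f.natDegree : ℝ) - 1)))))
      (⨆ i : Fin f.natDegree,
        ‖f.coeff i / f.leadingCoeff‖ ^ (1 / ((f.natDegree : ℝ) - (i : ℝ)))) ≤ A * N := by
    refine max_le (max_le hAN ?_) (ciSup_le fun i => ?_)
    · refine (Real.rpow_le_one_of_one_le_of_nonpos hlc ?_).trans hAN
      rw [neg_nonpos]
      exact one_div_nonneg.mpr (by linarith)
    · have hi : (0 : ℝ) < (f.natDegree : ℝ) - (i : ℝ) :=
        sub_pos.mpr (by exact_mod_cast i.isLt)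
      have hne : f.natDegree - (i : ℕ) ≠ 0 := by
        have := i.isLt
        omega
      have hle : ‖f.coeff i / f.leadingCoeff‖ ≤ (A * N) ^ (f.natDegree - (i : ℕ)) := by
        rw [norm_div, mul_pow]
        refine (div_le_self (norm_nonneg _) hlc).trans ((hf i i.isLt.le).trans ?_)
        gcongr
        exact le_self_pow₀ hA hne
      refine (Real.rpow_le_rpow (norm_nonneg _) hle (by positivity)).trans_eq ?_
      rw [← Nat.cast_sub i.isLt.le, one_div]
      exact Real.pow_rpow_inv_natCast (by positivity) hne
  exact (mul_le_of_le_one_left (by positivity) h2d).trans hmax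

end Growth

/-! ### The polynomials `f_c` -/

section NormalForm

variable {F : Type*} [Field F]

theorem coeff_normalForm (d : ℕ) (c : Fin (d - 1) → F) {j : ℕ} (hj : 0 < j) (hjd : j ≤ d) :
    (normalForm d c).coeff j =
      (-1) ^ (d - j) * (Finset.univ.val.map c).esymm (d - j) / (j : F) := by
  rw [normalForm, finsetSum_coeff, Finset.sum_eq_single (d - j)]
  · rw [Nat.sub_sub_self hjd, coeff_C_mul_X_pow, if_pos rfl]
  · intro k hk hne
    have := Finset.mem_range.mp hk
    rw [coeff_C_mul_X_pow, if_neg (by omega)]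
  · intro h
    exact absurd (Finset.mem_range.mpr (by omega)) h

theorem coeff_zero_normalForm (d : ℕ) (c : Fin (d - 1) → F) : (normalForm d c).coeff 0 = 0 := by
  rw [normalForm, finsetSum_coeff]
  refine Finset.sum_eq_zero fun k hk => ?_
  have := Finset.mem_range.mp hk
  rw [coeff_C_mul_X_pow, if_neg (by omega)]

theorem coeff_self_normalForm {d : ℕ} (hd : 0 < d) (c : Fin (d - 1) → F) :
    (normalForm d c).coeff d = (d : F)⁻¹ := by
  rw [coeff_normalForm d c hd le_rfl, Nat.sub_self, Multiset.esymm]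
  simp

theorem natDegree_normalForm [CharZero F] {d : ℕ} (hd : 0 < d) (c : Fin (d - 1) → F) :
    (normalForm d c).natDegree = d := by
  refine natDegree_eq_of_le_of_coeff_ne_zero ?_ ?_
  · refine natDegree_sum_le_of_forall_le _ _ fun k _ => ?_
    exact (natDegree_C_mul_X_pow_le _ _).trans (Nat.sub_le _ _)
  · rw [coeff_self_normalForm hd]
    exact inv_ne_zero (Nat.cast_ne_zero.mpr hd.ne')

theorem leadingCoeff_normalForm [CharZero F] {d : ℕ} (hd : 0 < d) (c : Fin (d - 1) → F) :
    (normalForm d c).leadingCoeff = (d : F)⁻¹ := by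
  rw [leadingCoeff, natDegree_normalForm hd, coeff_self_normalForm hd]

theorem map_normalForm {E : Type*} [Field E] (φ : F →+* E) (d : ℕ) (c : Fin (d - 1) → F) :
    (normalForm d c).map φ = normalForm d (φ ∘ c) := by
  simp only [normalForm, Polynomial.map_sum, Polynomial.map_mul, map_C, Polynomial.map_pow, map_X,
    map_div₀, map_mul, map_pow, map_neg, map_one, map_natCast, Finset.esymm_map_val, map_sum,
    map_prod, Function.comp_apply]

theorem derivative_normalForm [CharZero F] {d : ℕ} (hd : 0 < d) (c : Fin (d - 1) → F) :
    derivative (normalForm d c) = ∏ i, (X - C (c i)) := by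
  have h := Multiset.prod_X_sub_X_eq_sum_esymm (Finset.univ.val.map c)
  rw [Multiset.map_map, Multiset.card_map, Finset.card_val, Finset.card_univ, Fintype.card_fin,
    Nat.sub_add_cancel hd] at h
  refine Eq.trans ?_ h.symm
  rw [normalForm, derivative_sum]
  refine Finset.sum_congr rfl fun k hk => ?_
  have hk' := Finset.mem_range.mp hk
  have hne : ((d - k : ℕ) : F) ≠ 0 := Nat.cast_ne_zero.mpr (by omega)
  rw [derivative_C_mul_X_pow, div_mul_cancel₀ _ hne, C_mul, C_pow, C_neg, C_1, mul_assoc,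
    show d - k - 1 = d - 1 - k by omega]

theorem eval_derivative_normalForm_eq_zero_iff [CharZero F] {d : ℕ} (hd : 0 < d)
    (c : Fin (d - 1) → F) (x : F) :
    (derivative (normalForm d c)).eval x = 0 ↔ ∃ i, x = c i := by
  rw [derivative_normalForm hd, eval_prod, Finset.prod_eq_zero_iff]
  simp [sub_eq_zero]

theorem norm_esymm_le {L : Type*} [NormedField L] [IsUltrametricDist L] {n : ℕ} (c : Fin n → L)
    {N : ℝ} (hN : 0 ≤ N) (hc : ∀ i, ‖c i‖ ≤ N) (k : ℕ) :
    ‖(Finset.univ.val.map c).esymm k‖ ≤ N ^ k := by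
  rw [Finset.esymm_map_val]
  refine IsUltrametricDist.norm_sum_le_of_forall_le_of_nonneg (by positivity) fun t ht => ?_
  rw [norm_prod, ← (Finset.mem_powersetCard.mp ht).2]
  exact (Finset.prod_le_prod (fun _ _ => norm_nonneg _) fun i _ => hc i).trans_eq
    (Finset.prod_const _)

theorem norm_coeff_normalForm_le {L : Type*} [NormedField L] [IsUltrametricDist L] {d : ℕ}
    (c : Fin (d - 1) → L) {A N : ℝ} (hA : ∀ j : ℕ, 0 < j → j ≤ d → ‖(j : L)‖⁻¹ ≤ A) (hA0 : 0 ≤ A)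
    (hN : 0 ≤ N) (hc : ∀ i, ‖c i‖ ≤ N) {j : ℕ} (hj : j ≤ d) :
    ‖(normalForm d c).coeff j‖ ≤ A * N ^ (d - j) := by
  rcases Nat.eq_zero_or_pos j with rfl | hj0
  · rw [coeff_zero_normalForm, norm_zero]
    positivity
  · rw [coeff_normalForm d c hj0 hj, norm_div, norm_mul, norm_pow, norm_neg, norm_one, one_pow,
      one_mul, div_eq_inv_mul]
    gcongr
    · exact hA j hj0 hj
    · exact norm_esymm_le c hN hc _

end NormalForm

/-! ### Preimages under the third iterate -/

section Main

variable {L : Type*} [NormedField L] [IsUltrametricDist L]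
  {F : Type*} [Field F] [IsAlgClosed F]

theorem le_of_pow_le_of_one_le {x B : ℝ} (hB : 1 ≤ B) {n : ℕ} (hn : n ≠ 0) (h : x ^ n ≤ B) :
    x ≤ B := by
  by_contra! hlt
  exact absurd ((le_self_pow₀ (hB.trans hlt.le) hn).trans h) (not_le.mpr hlt)

/-- The three successive pullbacks of `α = f^3(y)` and `0`. A large critical point `c` sets the
scale; the radius used in `exists_preimage_near` is `ρ = ε ‖c‖`. -/
theorem exists_root_iterate_three_near (ι : F →+* L) (p : F[X]) (hd : 2 ≤ p.natDegree)
    (h0 : p.coeff 0 = 0) (hlc : 1 ≤ ‖ι p.leadingCoeff‖) {A ε : ℝ} (hA : 1 ≤ A) (hε : 0 < ε)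
    (hε1 : ε ≤ 1) (hεd : ε < ‖(p.natDegree : L)‖) (c : L)
    (hc : (derivative (p.map ι)).eval c = 0) (hcA : A / ε ^ p.natDegree ≤ ‖c‖)
    (hcoeff : ∀ j ≤ p.natDegree, ‖(p.map ι).coeff j‖ ≤ A * ‖c‖ ^ (p.natDegree - j)) (y : L)
    (hy : ‖iter (p.map ι) 3 y‖ ≤ A * ‖c‖) :
    ∃ β : L, iter (p.map ι) 3 β = 0 ∧ ε * ‖c‖ * ‖y - β‖ ^ (p.natDegree - 1) ≤ A / ε := by
  set f := p.map ι with hf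
  set d := p.natDegree with hdd
  have hfd : f.natDegree = d := natDegree_map ι
  have hεd1 : ε ^ d ≤ 1 := pow_le_one₀ hε.le hε1
  have hc1 : 1 ≤ ‖c‖ :=
    ((one_le_div (by positivity)).mpr (hεd1.trans hA)).trans hcA
  have hB : 1 ≤ A / ε := (one_le_div hε).mpr (hε1.trans hA)
  have hρ0 : 0 ≤ ε * ‖c‖ := by positivity
  have hεdε : ε ^ d ≤ ε := pow_le_of_le_one hε.le hε1 (by omega)
  have hAc : A ≤ ε ^ d * ‖c‖ := by
    rwa [div_le_iff₀' (by positivity)] at hcA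
  have hρ1 : 1 ≤ ε * ‖c‖ := hA.trans (hAc.trans (by gcongr))
  have hρc : ε * ‖c‖ < ‖(d : L)‖ * ‖c‖ := by gcongr
  have hsmall : A * ‖c‖ ≤ (ε * ‖c‖) ^ d := by
    calc A * ‖c‖ ≤ ε ^ d * ‖c‖ * ‖c‖ := by gcongr
      _ = ε ^ d * ‖c‖ ^ 2 := by ring
      _ ≤ ε ^ d * ‖c‖ ^ d := by gcongr
      _ = _ := by rw [mul_pow]
  have hAc1 : 1 ≤ A * ‖c‖ := one_le_mul_of_one_le_of_one_le hA hc1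
  have hroot : ∀ x : L, ‖f.eval x‖ ≤ A * ‖c‖ → ‖x‖ ≤ A * ‖c‖ := by
    intro x hx
    refine norm_le_of_norm_eval_le (f := f) (by omega) ?_ hA hc1 (by rwa [hfd]) ?_
    · rwa [hf, leadingCoeff_map]
    · exact hx.trans (le_self_pow₀ hAc1 (by omega))
  have hnear := exists_preimage_near ι p hd h0 hlc c hc hρ0 hρc
  have hev : ∀ b : F, f.eval (ι b) = ι (p.eval b) := fun b => by
    rw [hf, eval_map, eval₂_at_apply]
  obtain ⟨b₂, hb₂, hy₂⟩ := hnear 0 (by simp only [map_zero, norm_zero]; positivity)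
    (f.eval (f.eval y))
  have hb₂' : ‖ι b₂‖ ≤ A * ‖c‖ := hroot _ (by rw [hev, hb₂, map_zero, norm_zero]; positivity)
  have hz₂ : ‖f.eval (f.eval y) - ι b₂‖ ≤ A / ε := by
    refine le_of_pow_le_of_one_le hB (n := d - 1) (by omega) ?_
    rw [le_div_iff₀ hε]
    rw [map_zero, sub_zero] at hy₂
    have h1 := hy₂.trans hy
    rw [mul_right_comm] at h1
    rw [mul_comm]
    exact le_of_mul_le_mul_right h1 (by positivity)
  obtain ⟨b₁, hb₁, hy₁⟩ := hnear b₂ (hb₂'.trans hsmall) (f.eval y)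
  have hb₁' : ‖ι b₁‖ ≤ A * ‖c‖ := hroot _ (by rwa [hev, hb₁])
  have hz₁ : ‖f.eval y - ι b₁‖ ≤ A / ε := by
    refine le_of_pow_le_of_one_le hB (n := d - 1) (by omega) ?_
    exact (le_mul_of_one_le_left (by positivity) hρ1).trans (hy₁.trans hz₂)
  obtain ⟨b, hb, hy₀⟩ := hnear b₁ (hb₁'.trans hsmall) y
  refine ⟨ι b, ?_, hy₀.trans hz₁⟩
  change f.eval (f.eval (f.eval (ι b))) = 0
  rw [hev, hev, hev, hb, hb₁, hb₂, map_zero]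

/-- The proposition over an arbitrary ultrametric field `L` in place of `ℂ_v`, for parameters in an
algebraically closed subfield of characteristic zero. The constant depends only on `d` and the
absolute values in `L` of the integers up to `d`. -/
theorem exists_forall_iInf_logAbs_sub_le [CharZero F] (d : ℕ) (hd : 2 ≤ d) :
    ∃ δ : ℝ, ∀ (ι : F →+* L) (c : Fin (d - 1) → F) (f : L[X]), f = (normalForm d c).map ι →
      ∀ α : L, α ∉ basinInfty f → ∀ y : L, iter f 3 y = α →
        (⨅ β ∈ {β : L | iter f 3 β = 0}, logAbs (y - β)) ≤
          ((-(1 / ((d : ℝ) - 1)) * maxCriticalRate f + δ : ℝ) : EReal) := by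
  -- `A` bounds `1 / |j|` for `1 ≤ j ≤ d`, where `1 / 0 = 0` makes the term `j = 0` harmless;
  -- `R` is the threshold that separates bounded from large parameters.
  set A : ℝ := 1 + ∑ j ∈ Finset.range (d + 1), ‖(j : L)‖⁻¹ with hAdef
  set ε : ℝ := ‖(d : L)‖ / 2 with hεdef
  set R : ℝ := A / ε ^ d with hRdef
  set m : ℝ := (d : ℝ) - 1 with hm
  refine ⟨Real.log (A * R) + 1 / m * Real.log (A ^ 2 * R) + 1 / m * Real.log (A ^ 2 * (A / ε / ε)),
    ?_⟩
  rintro ι c f rfl α hα y rfl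
  have : CharZero L := charZero_of_injective_ringHom ι.injective
  have hd2 : (2 : ℝ) ≤ d := by exact_mod_cast hd
  have hm0 : 0 < m := by rw [hm]; linarith
  have hm1 : m = ((d - 1 : ℕ) : ℝ) := by rw [hm, Nat.cast_sub (by omega), Nat.cast_one]
  have hdL : 0 < ‖(d : L)‖ := norm_pos_iff.mpr (Nat.cast_ne_zero.mpr (by omega))
  have hdL1 : ‖(d : L)‖ ≤ 1 := IsUltrametricDist.norm_natCast_le_one L d
  have hε : 0 < ε := by positivity
  have hε1 : ε ≤ 1 := by rw [hεdef]; linarith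
  have hεd : ε < ‖(d : L)‖ := by rw [hεdef]; linarith
  have hA : 1 ≤ A := le_add_of_nonneg_right (Finset.sum_nonneg fun j _ => by positivity)
  have hAj : ∀ j : ℕ, 0 < j → j ≤ d → ‖(j : L)‖⁻¹ ≤ A := fun j _ hj =>
    (Finset.single_le_sum (f := fun j : ℕ => ‖(j : L)‖⁻¹) (fun i _ => by positivity)
      (Finset.mem_range.mpr (Nat.lt_succ_of_le hj))).trans (le_add_of_nonneg_left zero_le_one)
  have hR : 1 ≤ R := (one_le_div (by positivity)).mpr ((pow_le_one₀ hε.le hε1).trans hA)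
  have hB : 1 ≤ A / ε := (one_le_div hε).mpr (hε1.trans hA)
  have hB' : 1 ≤ A / ε / ε := (one_le_div hε).mpr (hε1.trans hB)
  have hA2 : 1 ≤ A ^ 2 := one_le_pow₀ hA
  have hlog1 : 0 ≤ Real.log (A * R) := Real.log_nonneg (one_le_mul_of_one_le_of_one_le hA hR)
  have hlog2 : 0 ≤ 1 / m * Real.log (A ^ 2 * R) :=
    mul_nonneg (by positivity) (Real.log_nonneg (one_le_mul_of_one_le_of_one_le hA2 hR))
  have hlog3 : 0 ≤ 1 / m * Real.log (A ^ 2 * (A / ε / ε)) :=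
    mul_nonneg (by positivity) (Real.log_nonneg (one_le_mul_of_one_le_of_one_le hA2 hB'))
  have hpd : (normalForm d c).natDegree = d := natDegree_normalForm (by omega) c
  have hplc : 1 ≤ ‖ι (normalForm d c).leadingCoeff‖ := by
    rw [leadingCoeff_normalForm (by omega), map_inv₀, map_natCast, norm_inv]
    exact (one_le_inv₀ hdL).mpr hdL1
  set f := (normalForm d c).map ι with hf
  have hfc : f = normalForm d (ι ∘ c) := map_normalForm ι d c
  have hfd : f.natDegree = d := by rw [hf, natDegree_map, hpd]
  have hflc : 1 ≤ ‖f.leadingCoeff‖ := by rwa [hf, leadingCoeff_map]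
  have hcrit : ∀ x, (derivative f).eval x = 0 ↔ ∃ i, x = ι (c i) := by
    rw [hfc]
    exact eval_derivative_normalForm_eq_zero_iff (by omega) _
  have : Nonempty (Fin (d - 1)) := ⟨⟨0, by omega⟩⟩
  obtain ⟨i₀, hi₀⟩ := Finite.exists_max fun i => ‖ι (c i)‖
  set N : ℝ := max 1 ‖ι (c i₀)‖ with hN
  have hN1 : 1 ≤ N := le_max_left _ _
  have hcN : ∀ i, ‖ι (c i)‖ ≤ N := fun i => (hi₀ i).trans (le_max_right _ _)
  have hcoeff : ∀ j ≤ f.natDegree, ‖f.coeff j‖ ≤ A * N ^ (f.natDegree - j) := by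
    intro j hj
    rw [hfd] at hj ⊢
    rw [hfc]
    exact norm_coeff_normalForm_le (ι ∘ c) hAj (by linarith) (by linarith) hcN hj
  have hM : maxCriticalRate f ≤ Real.log (A ^ 2 * N) := by
    refine csSup_le (Set.Nonempty.image _ ⟨ι (c i₀), (hcrit _).mpr ⟨i₀, rfl⟩⟩) ?_
    rintro _ ⟨x, hx, rfl⟩
    obtain ⟨i, rfl⟩ := (hcrit x).mp hx
    exact escapeRate_le (by omega) hA hN1
      (fun ρ hρ z hz => norm_eval_le (by linarith) (by linarith) hcoeff hρ hz) (hcN i)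
  have hα' : ‖iter f 3 y‖ ≤ A * N := by
    refine le_trans ?_ (escapeRadius_le (f := f) (by omega) hflc hA hN1 hcoeff)
    simpa [basinInfty] using hα
  -- It suffices to exhibit one root of the third iterate close to `y`.
  suffices h : ∃ β, iter f 3 β = 0 ∧ ‖y - β‖ ≤ Real.exp (-(1 / m) * maxCriticalRate f +
      (Real.log (A * R) + 1 / m * Real.log (A ^ 2 * R) +
        1 / m * Real.log (A ^ 2 * (A / ε / ε)))) by
    obtain ⟨β, hβ, hle⟩ := h
    exact (iInf₂_le β hβ).trans (logAbs_le_of_norm_le_exp hle)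
  rcases le_or_gt N R with hNR | hRN
  · have hAN : 1 ≤ A * N := one_le_mul_of_one_le_of_one_le hA hN1
    have hroot : ∀ x : L, ‖f.eval x‖ ≤ A * N → ‖x‖ ≤ A * N := fun x hx =>
      norm_le_of_norm_eval_le (by omega) hflc hA hN1 hcoeff
        (hx.trans (le_self_pow₀ hAN (by omega)))
    have hfix : f.eval 0 = 0 := by
      rw [hfc, ← coeff_zero_eq_eval_zero, coeff_zero_normalForm]
    refine ⟨0, ?_, ?_⟩
    · change f.eval (f.eval (f.eval 0)) = 0
      rw [hfix, hfix, hfix]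
    · rw [sub_zero]
      have h1 : ‖y‖ ≤ A * R := (hroot y (hroot _ (hroot _ hα'))).trans (by gcongr)
      refine h1.trans ?_
      rw [← Real.log_le_iff_le_exp (by positivity)]
      have h2 : maxCriticalRate f ≤ Real.log (A ^ 2 * R) :=
        hM.trans (Real.log_le_log (by positivity) (by gcongr))
      have h3 := mul_le_mul_of_nonneg_left h2 (show 0 ≤ 1 / m by positivity)
      linarith
  · have hNc : N = ‖ι (c i₀)‖ := by
      refine max_eq_right (le_of_lt ?_)
      by_contra! h
      rw [hN, max_eq_left h] at hRN
      linarith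
    rw [hNc] at hRN hcoeff hα' hM
    obtain ⟨β, hβ, hle⟩ := exists_root_iterate_three_near ι (normalForm d c) (by omega)
      (coeff_zero_normalForm d c) hplc hA hε hε1 (by rwa [hpd]) (ι (c i₀))
      ((hcrit _).mpr ⟨i₀, rfl⟩) (by rw [hpd]; exact hRN.le)
      (by rw [hfd] at hcoeff; rwa [hpd]) y hα'
    refine ⟨β, hβ, ?_⟩
    rw [hpd] at hle
    have hc0 : 0 < ‖ι (c i₀)‖ := by linarith
    have h1 : ‖y - β‖ ^ (d - 1) ≤ A / ε / ε / ‖ι (c i₀)‖ := by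
      rw [le_div_iff₀ hc0, le_div_iff₀ hε]
      linarith
    refine le_of_pow_le_pow_left₀ (n := d - 1) (by omega) (Real.exp_pos _).le (h1.trans ?_)
    rw [← Real.exp_nat_mul, ← hm1, ← Real.log_le_iff_le_exp (by positivity),
      Real.log_div (by positivity) (by positivity)]
    rw [Real.log_mul (by positivity) (by positivity)] at hM
    rw [Real.log_mul (x := A ^ 2) (y := A / ε / ε) (by positivity) (by positivity)]
    have h4 : m * (1 / m) = 1 := mul_one_div_cancel hm0.ne'
    have h5 : 0 ≤ m * (Real.log (A * R) + 1 / m * Real.log (A ^ 2 * R)) := by positivity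
    calc Real.log (A / ε / ε) - Real.log ‖ι (c i₀)‖
        ≤ -maxCriticalRate f + (Real.log (A ^ 2) + Real.log (A / ε / ε)) +
            m * (Real.log (A * R) + 1 / m * Real.log (A ^ 2 * R)) := by linarith
      _ = _ := by
        linear_combination (maxCriticalRate f - (Real.log (A ^ 2) + Real.log (A / ε / ε))) * h4

end Main

end PolyDynamics

/-! ### The ultrametric inequality on `ℂ_v` -/

namespace NonarchPlace

variable {K : Type*} [Field K] [NumberField K] (v : NonarchPlace K)

theorem isUltrametricDist_algCl : IsUltrametricDist v.AlgCl :=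
  IsUltrametricDist.isUltrametricDist_of_forall_norm_add_le_max_norm fun x y =>
    isNonarchimedean_spectralNorm (K := v.LocalField) (L := v.AlgCl) x y

theorem isUltrametricDist_cv : IsUltrametricDist v.Cv := by
  have := v.isUltrametricDist_algCl
  refine IsUltrametricDist.isUltrametricDist_of_forall_norm_add_le_max_norm fun x y => ?_
  induction x, y using UniformSpace.Completion.induction_on₂ with
  | hp => exact isClosed_le (by fun_prop) (by fun_prop)
  | ih a b =>
    rw [← UniformSpace.Completion.coe_add]
    simp only [UniformSpace.Completion.norm_coe]
    exact IsUltrametricDist.norm_add_le_max a b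

end NonarchPlace

theorem proposition4p3 {K : Type*} [Field K] [NumberField K] (v : NonarchPlace K)
    (d : ℕ) (hd : 2 ≤ d) :
    ∃ δ : ℝ, ∀ (ι : AlgebraicClosure ℚ →+* v.Cv) (c : Fin (d - 1) → AlgebraicClosure ℚ)
      (f : Polynomial v.Cv), f = (PolyDynamics.normalForm d c).map ι →
      ∀ α : v.Cv, α ∉ PolyDynamics.basinInfty f →
      ∀ y : v.Cv, PolyDynamics.iter f 3 y = α →
        (⨅ β ∈ {β : v.Cv | PolyDynamics.iter f 3 β = 0}, PolyDynamics.logAbs (y - β)) ≤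
          ((-(1 / ((d : ℝ) - 1)) * PolyDynamics.maxCriticalRate f + δ : ℝ) : EReal) := by
  have := v.isUltrametricDist_cv
  exact PolyDynamics.exists_forall_iInf_logAbs_sub_le d hd
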